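/- For real $\alpha,\beta>-1$ let $$P_k^{(\alpha,\beta)}(x)=\sum_{s=0}^{k}\binom{k+\alpha}{k-s}\binom{k+\beta}{s}\Big(\frac{x-1}{2}\Big)^{s}\Big(\frac{x+1}{2}\Big)^{k-s}$$ denote the $k$-th Jacobi polynomial, so that $P_k^{(\alpha,\alpha)}$ are the ultraspherical polynomials (in the Jacobi normalization) and $P_k=P_k^{(0,0)}$ are the Legendre polynomials. Let $\alpha>-1$ and let $f(x)=\sum_{k=0}^n a_kx^k$ be a nonzero real polynomial all of whose complex zeros are real and lie in the open interval $(-1,1)$ (a nonzero constant, having no zeros, is included). Then $$T[f](x)=\sum_{k=0}^n a_k\,\frac{k!}{\Gamma(k+1+\alpha)}\,P_k^{(\alpha,\alpha)}(x)$$ is a nonzero polynomial all of whose complex zeros are real and lie in $(-1,1)$. In particular (the case $\alpha=0$, Fisk's conjecture), $\sum_{k=0}^n a_kP_k(x)$ is a nonzero polynomial all of whose complex zeros are real and lie in $(-1,1)$. -/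

import Mathlib

open Polynomial

noncomputable section

/-- The `n`-th Jacobi polynomial with (real) parameters `α`, `β`:
`P_n^{(α,β)}(x) = ∑_{s=0}^n binom(n+α, n-s) binom(n+β, s) ((x-1)/2)^s ((x+1)/2)^{n-s}`,
with generalized binomial coefficients `binom(r, k) = r (r-1) ⋯ (r-k+1) / k!`. -/
def jacobiPoly (α β : ℝ) (n : ℕ) : ℝ[X] :=
  ∑ s ∈ Finset.range (n + 1),
    C (Ring.choose ((n : ℝ) + α) (n - s) * Ring.choose ((n : ℝ) + β) s) *
      (C (1 / 2) * (X - 1)) ^ s * (C (1 / 2) * (X + 1)) ^ (n - s)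

/-- The ultraspherical polynomial `P_n^{(α,α)}`, in the Jacobi normalization. -/
def ultrasphericalPoly (α : ℝ) (n : ℕ) : ℝ[X] := jacobiPoly α α n

/-- The Legendre polynomial `P_n = P_n^{(0,0)}`. -/
def legendrePoly (n : ℕ) : ℝ[X] := jacobiPoly 0 0 n

/-- The map `∑ a_k x^k ↦ ∑ a_k (k! / Γ(k+1+α)) P_k^{(α,α)}(x)`. -/
def ultrasphericalTransform (α : ℝ) (f : ℝ[X]) : ℝ[X] :=
  ∑ k ∈ Finset.range (f.natDegree + 1),
    C (f.coeff k * ((Nat.factorial k : ℝ) / Real.Gamma ((k : ℝ) + 1 + α))) *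
      ultrasphericalPoly α k

/-- The map `∑ a_k x^k ↦ ∑ a_k P_k(x)`. -/
def legendreTransform (f : ℝ[X]) : ℝ[X] :=
  ∑ k ∈ Finset.range (f.natDegree + 1), C (f.coeff k) * legendrePoly k

/-- All complex zeros of the real polynomial `f` are real and lie in the open interval `(-1, 1)`.
The zero polynomial, which vanishes everywhere, does not have this property;
nonzero constants, which have no zeros, do. -/
def AllZerosInUnitInterval (f : ℝ[X]) : Prop :=
  ∀ z : ℂ, aeval z f = 0 → ∃ x : ℝ, x ∈ Set.Ioo (-1 : ℝ) 1 ∧ z = (x : ℂ)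

end

open Polynomial Filter Topology

/-! Up to the factor `Γ(α+1)`, `T[f](z) = ∑ (-(1-z²)/4)^j / (j! (α+1)_j) f^(2j)(z)`
(`aeval_ultrasphericalTransform`). Freeze `z` outside `(-1,1)` with `c² = 1 - z² ≠ 0`: a
constant-coefficient operator, a Bessel-type series in `c²D²`, is applied to `f` and evaluated at
`z`. It is the limit of `L_m(c²D²/(4m))`, with `L_m` the Laguerre polynomial scaled to `L_m(0) = 1`.
The zeros of `L_m` are positive, so the operator splits into factors `1 ± c s D` with `s` real. Each
factor keeps zeros inside any half plane with boundary parallel to `c`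
(`ZerosInHalfPlane.sub_C_mul_derivative`). Such a half plane can contain `[-1,1]` but not `z`
(`exists_abs_re_lt_re_mul`). Degree and leading coefficient are preserved, so the values at `z` stay
away from `0` uniformly in `m`, and the limit is nonzero. At `z = ±1` only the `j = 0` term, `f(z)`,
remains. -/

/-! ### The transform as a differential operator -/

/-- The Pochhammer symbol `(α + 1)_k = (α + 1) (α + 2) ⋯ (α + k)`. -/
noncomputable def shiftedPochhammer (α : ℝ) (k : ℕ) : ℝ := (ascPochhammer ℝ k).eval (α + 1)

theorem shiftedPochhammer_zero (α : ℝ) : shiftedPochhammer α 0 = 1 := by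
  simp [shiftedPochhammer]

theorem shiftedPochhammer_succ (α : ℝ) (k : ℕ) :
    shiftedPochhammer α (k + 1) = shiftedPochhammer α k * (α + 1 + k) :=
  ascPochhammer_succ_eval k (α + 1)

theorem shiftedPochhammer_succ_left (α : ℝ) (k : ℕ) :
    shiftedPochhammer α (k + 1) = (α + 1) * shiftedPochhammer (α + 1) k := by
  simp [shiftedPochhammer, ascPochhammer_succ_left]

theorem shiftedPochhammer_pos {α : ℝ} (hα : -1 < α) (k : ℕ) : 0 < shiftedPochhammer α k :=
  ascPochhammer_pos k _ (by linarith)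

theorem Gamma_add_natCast_eq {α : ℝ} (hα : -1 < α) (k : ℕ) :
    Real.Gamma (k + 1 + α) = shiftedPochhammer α k * Real.Gamma (α + 1) := by
  induction k with
  | zero => simp [shiftedPochhammer_zero, add_comm]
  | succ k ih =>
    have h : (k : ℝ) + 1 + α ≠ 0 := by have : (0:ℝ) ≤ k := k.cast_nonneg; linarith
    rw [shiftedPochhammer_succ, show ((k + 1 : ℕ) : ℝ) + 1 + α = (k + 1 + α) + 1 by push_cast; ring,
      Real.Gamma_add_one h, ih]
    ring

theorem choose_mul_factorial_mul_shiftedPochhammer (α : ℝ) (j d : ℕ) :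
    Ring.choose (((j + d : ℕ) : ℝ) + α) d * d.factorial * shiftedPochhammer α j =
      shiftedPochhammer α (j + d) := by
  have h := Ring.descPochhammer_eq_factorial_smul_choose (((j + d : ℕ) : ℝ) + α) d
  rw [descPochhammer_smeval_eq_ascPochhammer, ascPochhammer_smeval_eq_eval, nsmul_eq_mul] at h
  rw [shiftedPochhammer, shiftedPochhammer, ← ascPochhammer_mul, mul_comm _ (d.factorial : ℝ), ← h]
  rw [eval_mul, eval_comp]
  simp only [eval_add, eval_X, eval_natCast]
  rw [mul_comm]
  congr 2
  push_cast
  ring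

theorem choose_left_mul_factorial_mul_factorial (m n : ℕ) :
    (((m + n).choose m : ℕ) : ℝ) * m.factorial * n.factorial = (m + n).factorial := by
  rw [Nat.choose_symm_add]
  exact_mod_cast Nat.add_choose_mul_factorial_mul_factorial m n

/-- A form of the Chu–Vandermonde identity. -/
theorem sum_choose_mul_choose_div_shiftedPochhammer {α : ℝ} (hα : -1 < α) (s t : ℕ) :
    ∑ j ∈ Finset.range (s + 1),
        (s.choose j * t.choose j * j.factorial : ℝ) / shiftedPochhammer α j =
      shiftedPochhammer α (s + t) / (shiftedPochhammer α s * shiftedPochhammer α t) := by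
  have hs := (shiftedPochhammer_pos hα s).ne'
  have ht := (shiftedPochhammer_pos hα t).ne'
  have hf : (s.factorial : ℝ) ≠ 0 := by positivity
  -- Vandermonde for `binom(t + (s + α), s)`.
  have h := Ring.add_choose_eq s (Commute.all (t : ℝ) ((s : ℝ) + α))
  have hl := choose_mul_factorial_mul_shiftedPochhammer α t s
  rw [show (t : ℝ) + (s + α) = ((t + s : ℕ) : ℝ) + α by push_cast; ring,
    Finset.Nat.sum_antidiagonal_eq_sum_range_succ_mk] at h
  rw [add_comm s t, ← hl, h, Finset.sum_mul, Finset.sum_mul, Finset.sum_div]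
  refine Finset.sum_congr rfl fun j hj => ?_
  obtain ⟨d, rfl⟩ := Nat.exists_eq_add_of_le (Finset.mem_range_succ_iff.mp hj)
  have hj0 := (shiftedPochhammer_pos hα j).ne'
  have hl' := choose_mul_factorial_mul_shiftedPochhammer α j d
  have hc : (((j + d).choose j : ℕ) : ℝ) * j.factorial * d.factorial = (j + d).factorial :=
      choose_left_mul_factorial_mul_factorial j d
  simp only [Nat.add_sub_cancel_left, Ring.choose_natCast]
  rw [← hl'] at hs ⊢
  rw [← hc] at hf ⊢
  have hd : (d.factorial : ℝ) ≠ 0 := by positivity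
  have hR : Ring.choose (((j + d : ℕ) : ℝ) + α) d ≠ 0 := by
    intro h0
    rw [h0, zero_mul, zero_mul] at hs
    exact hs rfl
  field_simp

theorem choose_mul_choose_mul_choose (j i l : ℕ) :
    ((2 * j + (i + l)).choose (j + i) * (j + i).choose j * (j + l).choose j *
      (j.factorial * j.factorial) : ℝ) =
      (2 * j + (i + l)).descFactorial (2 * j) * (i + l).choose i := by
  have h1 : (((2 * j + (i + l)).choose (j + i) : ℕ) : ℝ) * (j + i).factorial * (j + l).factorial =
      (2 * j + (i + l)).factorial := by
    have := choose_left_mul_factorial_mul_factorial (j + i) (j + l)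
    rwa [show j + i + (j + l) = 2 * j + (i + l) by ring] at this
  have h2 : (((j + i).choose j : ℕ) : ℝ) * j.factorial * i.factorial = (j + i).factorial :=
      choose_left_mul_factorial_mul_factorial j i
  have h3 : (((j + l).choose j : ℕ) : ℝ) * j.factorial * l.factorial = (j + l).factorial :=
      choose_left_mul_factorial_mul_factorial j l
  have h4 : (((i + l).choose i : ℕ) : ℝ) * i.factorial * l.factorial = (i + l).factorial :=
      choose_left_mul_factorial_mul_factorial i l
  have h5 : ((i + l).factorial : ℝ) * (2 * j + (i + l)).descFactorial (2 * j) =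
      (2 * j + (i + l)).factorial := by
    have := Nat.factorial_mul_descFactorial (Nat.le_add_right (2 * j) (i + l))
    rw [Nat.add_sub_cancel_left] at this
    exact_mod_cast this
  have hil : (i.factorial * l.factorial : ℝ) ≠ 0 := by positivity
  refine mul_right_cancel₀ hil ?_
  rw [← h5, ← h4, ← h2, ← h3] at h1
  linear_combination h1

/-- Both sides are `(AB)^j ∂_A^j ∂_B^j (A + B)^k`, the left one expanded binomially. -/
theorem sum_choose_mul_choose_mul_pow (k j : ℕ) (A B : ℂ) :
    ∑ s ∈ Finset.range (k + 1),
        (k.choose s * s.choose j * (k - s).choose j * (j.factorial * j.factorial) : ℂ) *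
          (A ^ s * B ^ (k - s)) =
      (A * B) ^ j * k.descFactorial (2 * j) * (A + B) ^ (k - 2 * j) := by
  rcases lt_or_ge k (2 * j) with h | h
  · rw [Nat.descFactorial_of_lt h, Nat.cast_zero, mul_zero, zero_mul]
    refine Finset.sum_eq_zero fun s hs => ?_
    rcases lt_or_ge s j with h' | h'
    · simp [Nat.choose_eq_zero_of_lt h']
    · have : k - s < j := by omega
      simp [Nat.choose_eq_zero_of_lt this]
  · obtain ⟨N, rfl⟩ := Nat.exists_eq_add_of_le h
    rw [show 2 * j + N + 1 = j + ((N + 1) + j) by ring, Finset.sum_range_add,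
      Finset.sum_range_add, Nat.add_sub_cancel_left, add_pow, Finset.mul_sum]
    rw [Finset.sum_eq_zero, zero_add, add_eq_left.mpr]
    · refine Finset.sum_congr rfl fun i hi => ?_
      obtain ⟨l, rfl⟩ := Nat.exists_eq_add_of_le (Finset.mem_range_succ_iff.mp hi)
      have h := congrArg (fun x : ℝ => (x : ℂ)) (choose_mul_choose_mul_choose j i l)
      push_cast at h
      rw [show 2 * j + (i + l) - (j + i) = j + l by omega, Nat.add_sub_cancel_left, h]
      ring
    · refine Finset.sum_eq_zero fun i hi => ?_
      have hi' := Finset.mem_range.mp hi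
      have : 2 * j + N - (j + (N + 1 + i)) < j := by omega
      simp [Nat.choose_eq_zero_of_lt this]
    · intro s hs
      simp [Nat.choose_eq_zero_of_lt (Finset.mem_range.mp hs)]

/-- With `A = (z-1)/2` and `B = (z+1)/2`, Chu–Vandermonde expands each coefficient of `A^s B^(k-s)`
as a sum over `j`. Exchanging the sums leaves `sum_choose_mul_choose_mul_pow`, where `A + B = z` and
`AB = -(1-z²)/4`. -/
theorem aeval_ultrasphericalPoly {α : ℝ} (hα : -1 < α) (k : ℕ) (z : ℂ) :
    ((k.factorial / shiftedPochhammer α k : ℝ) : ℂ) * aeval z (ultrasphericalPoly α k) =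
      ∑ j ∈ Finset.range (k + 1), (-((1 - z ^ 2) / 4)) ^ j /
        (j.factorial * shiftedPochhammer α j : ℝ) *
          (k.descFactorial (2 * j) * z ^ (k - 2 * j)) := by
  set A : ℂ := (z - 1) / 2 with hA
  set B : ℂ := (z + 1) / 2 with hB
  have hAB : -((1 - z ^ 2) / 4) = A * B := by rw [hA, hB]; ring
  have hz : z = A + B := by rw [hA, hB]; ring
  have hj : ∀ j, (shiftedPochhammer α j : ℂ) ≠ 0 := fun j =>
    Complex.ofReal_ne_zero.mpr (shiftedPochhammer_pos hα j).ne'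
  have key : ∀ s ∈ Finset.range (k + 1),
      (k.factorial / shiftedPochhammer α k : ℝ) *
        (Ring.choose ((k : ℝ) + α) (k - s) * Ring.choose ((k : ℝ) + α) s) =
      ∑ j ∈ Finset.range (k + 1), (k.choose s * s.choose j * (k - s).choose j * j.factorial : ℝ) /
        shiftedPochhammer α j := by
    intro s hs
    obtain ⟨t, rfl⟩ := Nat.exists_eq_add_of_le (Finset.mem_range_succ_iff.mp hs)
    have h1 := choose_mul_factorial_mul_shiftedPochhammer α s t
    have h2 := choose_mul_factorial_mul_shiftedPochhammer α t s
    have h3 : (((s + t).choose s : ℕ) : ℝ) * s.factorial * t.factorial = (s + t).factorial :=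
      choose_left_mul_factorial_mul_factorial s t
    have h4 := sum_choose_mul_choose_div_shiftedPochhammer hα s t
    rw [Nat.add_sub_cancel_left]
    rw [show s + t + 1 = (s + 1) + t by ring, Finset.sum_range_add, Finset.sum_eq_zero (s := .range t),
      add_zero]
    · have h5 : ∀ j ∈ Finset.range (s + 1), (((s + t).choose s : ℕ) * s.choose j * t.choose j *
          j.factorial : ℝ) / shiftedPochhammer α j = ((s + t).choose s : ℕ) *
          ((s.choose j * t.choose j * j.factorial : ℝ) / shiftedPochhammer α j) := by
        intros; ring
      rw [Finset.sum_congr rfl h5, ← Finset.mul_sum, h4, ← h3]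
      rw [add_comm t s] at h2
      have hs0 := (shiftedPochhammer_pos hα s).ne'
      have ht0 := (shiftedPochhammer_pos hα t).ne'
      have hst0 := (shiftedPochhammer_pos hα (s + t)).ne'
      field_simp
      have h12 := congrArg₂ (· * ·) h1 h2
      linear_combination ((s + t).choose s : ℝ) * h12
    · intro i _
      have : s < s + 1 + i := by omega
      simp [Nat.choose_eq_zero_of_lt this]
  have hL : ((k.factorial / shiftedPochhammer α k : ℝ) : ℂ) * aeval z (ultrasphericalPoly α k) =
      ∑ s ∈ Finset.range (k + 1), (((k.factorial / shiftedPochhammer α k : ℝ) *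
        (Ring.choose ((k : ℝ) + α) (k - s) * Ring.choose ((k : ℝ) + α) s) : ℝ) : ℂ) *
          (A ^ s * B ^ (k - s)) := by
    rw [ultrasphericalPoly, jacobiPoly, map_sum, Finset.mul_sum]
    refine Finset.sum_congr rfl fun s _ => ?_
    have e1 : aeval z (C (1 / 2 : ℝ) * (X - 1)) = A := by
      simp [hA]; ring
    have e2 : aeval z (C (1 / 2 : ℝ) * (X + 1)) = B := by
      simp [hB]; ring
    rw [map_mul, map_mul, map_pow, map_pow, e1, e2, aeval_C, Complex.coe_algebraMap]
    push_cast
    ring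
  rw [hL, hAB, Finset.sum_congr rfl fun s hs => by rw [key s hs]]
  push_cast
  simp_rw [Finset.sum_mul]
  rw [Finset.sum_comm]
  refine Finset.sum_congr rfl fun j _ => ?_
  have h := sum_choose_mul_choose_mul_pow k j A B
  rw [← hz] at h
  have hjf : (j.factorial : ℂ) ≠ 0 := by exact_mod_cast j.factorial_ne_zero
  rw [div_mul_eq_mul_div, ← mul_assoc, ← h, Finset.sum_div]
  refine Finset.sum_congr rfl fun s _ => ?_
  have := hj j
  field_simp

theorem aeval_ultrasphericalTransform {α : ℝ} (hα : -1 < α) (f : ℝ[X]) (z : ℂ) :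
    Real.Gamma (α + 1) * aeval z (ultrasphericalTransform α f) =
      ∑ j ∈ Finset.range (f.natDegree + 1), (-((1 - z ^ 2) / 4)) ^ j /
        (j.factorial * shiftedPochhammer α j : ℝ) * aeval z (derivative^[2 * j] f) := by
  have hG : (Real.Gamma (α + 1) : ℂ) ≠ 0 :=
    Complex.ofReal_ne_zero.mpr (Real.Gamma_pos_of_pos (by linarith)).ne'
  have hd : ∀ j, aeval z (derivative^[2 * j] f) = ∑ k ∈ Finset.range (f.natDegree + 1),
      (f.coeff k : ℂ) * (k.descFactorial (2 * j) * z ^ (k - 2 * j)) := by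
    intro j
    conv_lhs => rw [f.as_sum_range_C_mul_X_pow]
    rw [iterate_derivative_sum, map_sum]
    refine Finset.sum_congr rfl fun k _ => ?_
    rw [iterate_derivative_C_mul, iterate_derivative_X_pow_eq_natCast_mul]
    simp
  simp_rw [hd, Finset.mul_sum]
  rw [Finset.sum_comm, ultrasphericalTransform, map_sum, Finset.mul_sum]
  refine Finset.sum_congr rfl fun k hk => ?_
  have hk' := Finset.mem_range_succ_iff.mp hk
  have hp : (shiftedPochhammer α k : ℂ) ≠ 0 :=
    Complex.ofReal_ne_zero.mpr (shiftedPochhammer_pos hα k).ne'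
  have h := aeval_ultrasphericalPoly hα k z
  have hs : ∑ j ∈ Finset.range (k + 1), (-((1 - z ^ 2) / 4)) ^ j /
        (j.factorial * shiftedPochhammer α j : ℝ) *
          (k.descFactorial (2 * j) * z ^ (k - 2 * j)) =
      ∑ j ∈ Finset.range (f.natDegree + 1), (-((1 - z ^ 2) / 4)) ^ j /
        (j.factorial * shiftedPochhammer α j : ℝ) *
          (k.descFactorial (2 * j) * z ^ (k - 2 * j)) := by
    refine Finset.sum_subset (Finset.range_subset_range.mpr (by omega)) fun j _ hj => ?_
    have : k < 2 * j := by simp at hj; omega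
    simp [Nat.descFactorial_of_lt this]
  rw [hs] at h
  simp_rw [mul_left_comm _ (f.coeff k : ℂ)]
  rw [← Finset.mul_sum, ← h, map_mul, aeval_C, Complex.coe_algebraMap, Gamma_add_natCast_eq hα]
  push_cast
  field_simp

/-! ### Positivity of the Laguerre zeros -/

/-- The Laguerre polynomial `L_m^{(α)}`, normalized to take the value `1` at `0`. -/
noncomputable def normalizedLaguerre (m : ℕ) (α : ℝ) : ℂ[X] :=
  ∑ k ∈ Finset.range (m + 1), C (((-1) ^ k * m.choose k / shiftedPochhammer α k : ℝ) : ℂ) * X ^ k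

theorem coeff_normalizedLaguerre (m : ℕ) (α : ℝ) (k : ℕ) :
    (normalizedLaguerre m α).coeff k = ((-1) ^ k * m.choose k / shiftedPochhammer α k : ℝ) := by
  simp only [normalizedLaguerre, finsetSum_coeff, coeff_C_mul_X_pow]
  rw [Finset.sum_ite_eq]
  split_ifs with h
  · rfl
  · rw [Finset.mem_range, not_lt] at h
    simp [Nat.choose_eq_zero_of_lt h]

theorem eval_zero_normalizedLaguerre (m : ℕ) (α : ℝ) : (normalizedLaguerre m α).eval 0 = 1 := by
  rw [← coeff_zero_eq_eval_zero, coeff_normalizedLaguerre]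
  simp [shiftedPochhammer_zero]

/-- Raises the degree while lowering the parameter, so the induction on `m` must run over all `α` at
once. -/
theorem normalizedLaguerre_succ {α : ℝ} (hα : -1 < α) (m : ℕ) :
    C ((α + 1 : ℝ) : ℂ) * normalizedLaguerre (m + 1) α =
      X * derivative (normalizedLaguerre m (α + 1)) +
        (C ((α + 1 : ℝ) : ℂ) - X) * normalizedLaguerre m (α + 1) := by
  have hβ : α + 1 ≠ 0 := by linarith
  ext k
  rw [sub_mul, coeff_add, coeff_sub, coeff_C_mul, coeff_C_mul]
  cases k with
  | zero =>
    simp [coeff_normalizedLaguerre, shiftedPochhammer_zero]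
  | succ k =>
    have hk := (shiftedPochhammer_pos (show -1 < α + 1 by linarith) k).ne'
    have hk' : α + 1 + 1 + k ≠ 0 := by
      have : (0 : ℝ) ≤ k := k.cast_nonneg
      linarith
    rw [coeff_X_mul, coeff_X_mul, coeff_derivative]
    simp only [coeff_normalizedLaguerre]
    rw [shiftedPochhammer_succ_left, shiftedPochhammer_succ, Nat.choose_succ_succ]
    norm_cast
    push_cast
    field_simp
    ring

/-- All complex zeros are real and positive. -/
def HasPositiveZeros (p : ℂ[X]) : Prop :=
  ∀ w : ℂ, p.eval w = 0 → ∃ r : ℝ, 0 < r ∧ w = r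

/-- At a new zero `w`, `∑ w/(w-a) + β - w = 0` over the roots `a > 0` of `q`. Each `Im (w/(w-a))` is
a nonpositive multiple of `Im w`, as is `Im (-w)`, so `w` is real; for real `w ≤ 0` the left side
would be positive. -/
theorem HasPositiveZeros.X_mul_derivative_add {q : ℂ[X]} (hq : HasPositiveZeros q) (h0 : q ≠ 0)
    {β : ℝ} (hβ : 0 < β) :
    HasPositiveZeros (X * derivative q + (C (β : ℂ) - X) * q) := by
  intro w hw
  by_cases hqw : q.eval w = 0
  · exact hq w hqw
  simp only [eval_add, eval_mul, eval_X, eval_sub, eval_C] at hw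
  have hlog := (IsAlgClosed.splits q).eval_derivative_div_eval_of_ne_zero hqw
  have hroots : ∀ a ∈ q.roots, ∃ r : ℝ, 0 < r ∧ a = r := fun a ha =>
    hq a ((mem_roots h0).mp ha)
  have hsum : w * (q.roots.map fun a => 1 / (w - a)).sum + (β - w) = 0 := by
    rw [← hlog]
    field_simp
    linear_combination hw
  rw [← Multiset.sum_map_mul_left] at hsum
  have him : ∀ x ∈ q.roots.map (fun a => w * (1 / (w - a))), x.im * w.im ≤ 0 := by
    intro x hx
    obtain ⟨a, ha, rfl⟩ := Multiset.mem_map.mp hx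
    obtain ⟨r, hr, rfl⟩ := hroots a ha
    rw [mul_one_div, Complex.div_im, Complex.sub_re, Complex.sub_im, Complex.ofReal_re,
      Complex.ofReal_im, sub_zero, ← sub_div, div_mul_eq_mul_div]
    refine div_nonpos_of_nonpos_of_nonneg ?_ (Complex.normSq_nonneg _)
    nlinarith [mul_nonneg hr.le (sq_nonneg w.im)]
  have hre : w.im = 0 → w.re ≤ 0 → ∀ x ∈ q.roots.map (fun a => w * (1 / (w - a))), 0 ≤ x.re := by
    intro h1 h2 x hx
    obtain ⟨a, ha, rfl⟩ := Multiset.mem_map.mp hx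
    obtain ⟨r, hr, rfl⟩ := hroots a ha
    rw [mul_one_div, Complex.div_re, Complex.sub_re, Complex.sub_im, Complex.ofReal_re,
      Complex.ofReal_im, h1, zero_mul, zero_div, add_zero]
    exact div_nonneg (by nlinarith) (Complex.normSq_nonneg _)
  generalize q.roots.map (fun a => w * (1 / (w - a))) = S at hsum him hre
  have hSim : S.sum.im * w.im ≤ 0 :=
    Multiset.sum_induction (fun x : ℂ => x.im * w.im ≤ 0) S
      (fun x y hx hy => by rw [Complex.add_im, add_mul]; exact add_nonpos hx hy) (by simp) him
  have hSre : w.im = 0 → w.re ≤ 0 → 0 ≤ S.sum.re := fun h1 h2 =>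
    Multiset.sum_induction (fun x : ℂ => 0 ≤ x.re) S
      (fun x y hx hy => add_nonneg hx hy) le_rfl (hre h1 h2)
  have h1 := congrArg Complex.re hsum
  have h2 := congrArg Complex.im hsum
  simp at h1 h2
  have hwim : w.im = 0 := by nlinarith [sq_nonneg w.im]
  have hwre : 0 < w.re := by
    by_contra h
    have := hSre hwim (by linarith)
    linarith
  exact ⟨w.re, hwre, Complex.ext (by simp) (by simpa using hwim)⟩

theorem hasPositiveZeros_normalizedLaguerre (m : ℕ) {α : ℝ} (hα : -1 < α) :
    HasPositiveZeros (normalizedLaguerre m α) := by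
  induction m generalizing α with
  | zero =>
    intro w hw
    simp [normalizedLaguerre, shiftedPochhammer_zero] at hw
  | succ m ih =>
    intro w hw
    have h0 : normalizedLaguerre m (α + 1) ≠ 0 := fun h => by
      have := eval_zero_normalizedLaguerre m (α + 1)
      simp [h] at this
    refine (ih (α := α + 1) (by linarith)).X_mul_derivative_add h0 (β := α + 1) (by linarith) w ?_
    rw [← normalizedLaguerre_succ hα, eval_mul, hw, mul_zero]

/-! ### Operators preserving half planes -/

/-- All complex zeros of `g` lie in the closed half plane `{w | Re (u w) ≤ M}`. -/
def ZerosInHalfPlane (u : ℂ) (M : ℝ) (g : ℂ[X]) : Prop :=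
  ∀ w : ℂ, g.eval w = 0 → (u * w).re ≤ M

/-- At a zero `w` outside the half plane, `∑ 1/(w-a) = 1/c` over the roots `a`. After division by
`u` every summand has positive real part, while `1/(uc)` is purely imaginary. -/
theorem ZerosInHalfPlane.sub_C_mul_derivative {u : ℂ} {M : ℝ} {g : ℂ[X]}
    (hg : ZerosInHalfPlane u M g) {c : ℂ} (hc : (u * c).re = 0) :
    ZerosInHalfPlane u M (g - C c * derivative g) := by
  intro w hw
  by_contra! hM
  have hgw : g.eval w ≠ 0 := fun h => (hg w h).not_gt hM
  have h0 : g ≠ 0 := fun h => hgw (by simp [h])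
  have hlog := (IsAlgClosed.splits g).eval_derivative_div_eval_of_ne_zero hgw
  simp only [eval_sub, eval_mul, eval_C] at hw
  have hsum : c * (g.roots.map fun a => 1 / (w - a)).sum = 1 := by
    rw [← hlog]
    field_simp
    linear_combination -hw
  have hpos : ∀ x ∈ g.roots.map (fun a => 1 / (w - a)), 0 < (x / u).re := by
    intro x hx
    obtain ⟨a, ha, rfl⟩ := Multiset.mem_map.mp hx
    have ha' := hg a ((mem_roots h0).mp ha)
    have hlt : 0 < ((w - a) * u).re := by
      rw [mul_comm, mul_sub, Complex.sub_re]
      linarith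
    rw [div_div, one_div, Complex.inv_re]
    refine div_pos hlt (Complex.normSq_pos.mpr fun h => ?_)
    rw [h, Complex.zero_re] at hlt
    exact hlt.false
  have hne : g.roots.map (fun a => 1 / (w - a)) ≠ 0 := by
    intro h
    rw [h, Multiset.sum_zero, mul_zero] at hsum
    exact zero_ne_one hsum
  have hlt := Multiset.sum_induction_nonempty (fun x : ℂ => 0 < (x / u).re)
    (fun x y hx hy => by rw [add_div, Complex.add_re]; exact add_pos hx hy) hne hpos
  rw [eq_one_div_of_mul_eq_one_right hsum, div_div, one_div, Complex.inv_re, mul_comm c u, hc,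
    zero_div] at hlt
  exact hlt.false

theorem natDegree_sub_C_mul_derivative (g : ℂ[X]) (c : ℂ) :
    (g - C c * derivative g).natDegree = g.natDegree ∧
      (g - C c * derivative g).leadingCoeff = g.leadingCoeff := by
  rcases Nat.eq_zero_or_pos g.natDegree with h | h
  · simp [derivative_of_natDegree_zero h]
  · have hlt : (C c * derivative g).natDegree < g.natDegree :=
      (natDegree_C_mul_le _ _).trans_lt (natDegree_derivative_lt h.ne')
    exact ⟨natDegree_sub_eq_left_of_natDegree_lt hlt,
      leadingCoeff_sub_of_degree_lt (degree_lt_degree hlt)⟩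

theorem ZerosInHalfPlane.aeval_derivative_sq {u : ℂ} {M : ℝ} {c : ℂ} (hc : (u * c).re = 0)
    {t : ℝ} (ht : 0 ≤ t) {g : ℂ[X]} (hg : ZerosInHalfPlane u M g) {Q : ℂ[X]}
    (hQ : HasPositiveZeros Q) :
    ZerosInHalfPlane u M (aeval ((c ^ 2 * t) • (derivative : Module.End ℂ ℂ[X]) ^ 2) Q g) ∧
      (aeval ((c ^ 2 * t) • (derivative : Module.End ℂ ℂ[X]) ^ 2) Q g).natDegree = g.natDegree ∧
      (aeval ((c ^ 2 * t) • (derivative : Module.End ℂ ℂ[X]) ^ 2) Q g).leadingCoeff =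
        Q.eval 0 * g.leadingCoeff := by
  induction hn : Q.natDegree generalizing Q with
  | zero =>
    obtain ⟨q, rfl⟩ := natDegree_eq_zero.mp hn
    have hq : q ≠ 0 := by
      rintro rfl
      obtain ⟨r, hr, h⟩ := hQ 0 (by simp)
      exact hr.ne (by exact_mod_cast h)
    have h : aeval ((c ^ 2 * t) • (derivative : Module.End ℂ ℂ[X]) ^ 2) (C q) g = C q * g := by
      rw [aeval_C, Module.algebraMap_end_apply, smul_eq_C_mul]
    rw [h, natDegree_C_mul hq, leadingCoeff_mul, leadingCoeff_C, eval_C]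
    refine ⟨fun w hw => hg w ?_, rfl, rfl⟩
    simpa [hq] using hw
  | succ n ih =>
    obtain ⟨a, ha⟩ := IsAlgClosed.exists_root Q (degree_ne_of_natDegree_ne (n := 0) (by simp [hn]))
    obtain ⟨r, hr, rfl⟩ := hQ a ha
    obtain ⟨R, rfl⟩ := dvd_iff_isRoot.mpr ha
    have hR0 : R ≠ 0 := by
      rintro rfl
      simp at hn
    have hR : HasPositiveZeros R := fun w hw => hQ w (by rw [eval_mul, hw, mul_zero])
    obtain ⟨h1, h2, h3⟩ := ih hR (by
      rw [natDegree_mul (X_sub_C_ne_zero _) hR0, natDegree_X_sub_C] at hn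
      omega)
    set h := aeval ((c ^ 2 * t) • (derivative : Module.End ℂ ℂ[X]) ^ 2) R g with hh
    -- As `r > 0`, `s` is real, and `c²tD² - r = -r (1 - csD)(1 + csD)`.
    obtain ⟨s, hs⟩ : ∃ s : ℝ, s ^ 2 = t / r := ⟨√(t / r), Real.sq_sqrt (by positivity)⟩
    set k := h - C (c * s) * derivative h with hk
    have hr' : (r : ℂ) ≠ 0 := by exact_mod_cast hr.ne'
    have hs' : c ^ 2 * t = r * (c * s) ^ 2 := by
      have : (s : ℂ) ^ 2 = t / r := by exact_mod_cast congrArg (fun x : ℝ => (x : ℂ)) hs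
      rw [mul_pow, this]
      field_simp
    have hfac : aeval ((c ^ 2 * t) • (derivative : Module.End ℂ ℂ[X]) ^ 2)
        ((X - C (r : ℂ)) * R) g = C (-r : ℂ) * (k - C (-(c * s)) * derivative k) := by
      rw [map_mul, Module.End.mul_apply, ← hh, map_sub, aeval_X, aeval_C, LinearMap.sub_apply,
        LinearMap.smul_apply, Module.algebraMap_end_apply, hs', pow_two derivative,
        Module.End.mul_apply,
        smul_eq_C_mul, smul_eq_C_mul, hk, derivative_sub, derivative_C_mul]
      simp only [map_neg, map_mul, map_pow]
      ring
    have hcs : (u * (c * s)).re = 0 := by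
      rw [← mul_assoc, Complex.re_mul_ofReal, hc, zero_mul]
    have hkz : ZerosInHalfPlane u M k := h1.sub_C_mul_derivative hcs
    have hz := hkz.sub_C_mul_derivative (c := -(c * s)) (by
      rw [mul_neg, Complex.neg_re, hcs, neg_zero])
    obtain ⟨d1, l1⟩ := natDegree_sub_C_mul_derivative h (c * s)
    obtain ⟨d2, l2⟩ := natDegree_sub_C_mul_derivative k (-(c * s))
    rw [hfac, natDegree_C_mul (neg_ne_zero.mpr hr'), leadingCoeff_mul, leadingCoeff_C, d2, l2, hk,
      d1, l1, h2, h3]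
    refine ⟨fun w hw => hz w ?_, rfl, ?_⟩
    · rw [eval_mul, eval_C] at hw
      exact (mul_eq_zero.mp hw).resolve_left (neg_ne_zero.mpr hr')
    · simp
      ring

/-- Every root is at least as far from `z` as the half plane is. -/
theorem ZerosInHalfPlane.le_norm_eval {u : ℂ} {M : ℝ} {g : ℂ[X]} (hg : ZerosInHalfPlane u M g)
    (h0 : g ≠ 0) {z : ℂ} (hz : M < (u * z).re) :
    ‖g.leadingCoeff‖ * (((u * z).re - M) / ‖u‖) ^ g.natDegree ≤ ‖g.eval z‖ := by
  have hδ : 0 ≤ ((u * z).re - M) / ‖u‖ := div_nonneg (by linarith) (norm_nonneg _)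
  have hroots : ∀ a ∈ g.roots, ((u * z).re - M) / ‖u‖ ≤ ‖z - a‖ := by
    intro a ha
    have ha' := hg a ((mem_roots h0).mp ha)
    refine div_le_of_le_mul₀ (norm_nonneg _) (norm_nonneg _) ?_
    rw [← norm_mul]
    refine le_trans ?_ (Complex.re_le_norm _)
    rw [mul_comm (z - a), mul_sub, Complex.sub_re]
    linarith
  have hprod : ∀ S : Multiset ℂ, (∀ a ∈ S, ((u * z).re - M) / ‖u‖ ≤ ‖z - a‖) →
      (((u * z).re - M) / ‖u‖) ^ S.card ≤ ‖(S.map fun a => z - a).prod‖ := by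
    intro S
    induction S using Multiset.induction with
    | empty => simp
    | cons a S ih =>
      intro h
      rw [Multiset.card_cons, Multiset.map_cons, Multiset.prod_cons, norm_mul, pow_succ']
      exact mul_le_mul (h a (Multiset.mem_cons_self a S))
        (ih fun b hb => h b (Multiset.mem_cons_of_mem hb)) (pow_nonneg hδ _) (norm_nonneg _)
  have hs := IsAlgClosed.splits g
  rw [hs.eval_eq_prod_roots, norm_mul, hs.natDegree_eq_card_roots]
  exact mul_le_mul_of_nonneg_left (hprod _ hroots) (norm_nonneg _)

/-! ### The separating half plane -/

/-- Geometrically: the tangent at `z ∉ [-1, 1]` of the ellipse through `z` with foci `±1`, whose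
direction is `c = √(1 - z ^ 2)`, does not meet the segment between the foci. -/
theorem exists_abs_re_lt_re_mul {z c : ℂ} (hz : ¬∃ x : ℝ, x ∈ Set.Ioo (-1 : ℝ) 1 ∧ z = x)
    (hc : c ^ 2 = 1 - z ^ 2) (hc0 : c ≠ 0) :
    ∃ u : ℂ, (u * c).re = 0 ∧ |u.re| < (u * z).re := by
  -- Write `p = 1/c`, `s = z/c`, so `p² - s² = 1`. One of `u = ±ip` works once `|Im p| < |Im s|`.
  -- Otherwise `p` and `s` are real and `z = s/p` lies in `(-1,1)`.
  have hps : (1 / c) ^ 2 - (z / c) ^ 2 = 1 := by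
    field_simp
    exact hc.symm
  have hzps : z * (1 / c) = z / c := mul_one_div z c
  have hpc : Complex.I * (1 / c) * c = Complex.I := by field_simp
  have hus : Complex.I * (1 / c) * z = Complex.I * (z / c) := by ring
  have hur : (Complex.I * (1 / c)).re = -(1 / c).im := by simp
  generalize 1 / c = p at *
  generalize z / c = s at *
  have hlt : |p.im| < |s.im| := by
    rw [← sq_lt_sq]
    by_contra! hle
    have h1 := congrArg Complex.re hps
    have h2 := congrArg Complex.im hps
    simp [pow_two] at h1 h2
    have h3 : p.re * p.im = s.re * s.im := by linarith
    have h4 : 1 ≤ p.re ^ 2 - s.re ^ 2 := by nlinarith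
    have h5 : p.im ^ 2 * (p.re ^ 2 - s.re ^ 2) ≤ 0 := by
      have : p.re ^ 2 * p.im ^ 2 = s.re ^ 2 * s.im ^ 2 := by
        rw [← mul_pow, ← mul_pow, h3]
      nlinarith [mul_le_mul_of_nonneg_left hle (sq_nonneg s.re)]
    have h6 : p.im = 0 := by
      have : p.im ^ 2 ≤ 0 := by nlinarith [sq_nonneg p.im]
      nlinarith
    have h7 : s.im = 0 := by
      rw [h6] at hle
      nlinarith
    have hp : p.re ≠ 0 := fun h => by
      rw [h] at h4
      nlinarith [sq_nonneg s.re]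
    have hpr : p = (p.re : ℂ) := Complex.ext (by simp) (by simp [h6])
    have hsr : s = (s.re : ℂ) := Complex.ext (by simp) (by simp [h7])
    refine hz ⟨s.re / p.re, ?_, ?_⟩
    · rw [Set.mem_Ioo, ← abs_lt, ← sq_lt_one_iff_abs_lt_one, div_pow,
        div_lt_one (by positivity)]
      linarith
    · have : (p.re : ℂ) ≠ 0 := by exact_mod_cast hp
      push_cast
      rw [eq_div_iff this, ← hpr, ← hsr, hzps]
  have his : (Complex.I * s).re = -s.im := by simp
  rcases le_total 0 s.im with h | h
  · rw [abs_of_nonneg h] at hlt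
    refine ⟨-(Complex.I * p), ?_, ?_⟩
    · rw [neg_mul, hpc, Complex.neg_re, Complex.I_re, neg_zero]
    · rw [neg_mul, hus, Complex.neg_re, Complex.neg_re, hur, his, neg_neg, neg_neg]
      exact hlt
  · rw [abs_of_nonpos h] at hlt
    refine ⟨Complex.I * p, ?_, ?_⟩
    · rw [hpc, Complex.I_re]
    · rw [hus, hur, his, abs_neg]
      exact hlt

/-! ### Passage to the limit -/

theorem tendsto_choose_div_pow (k : ℕ) :
    Tendsto (fun m : ℕ => (m.choose k : ℝ) / (m : ℝ) ^ k) atTop (𝓝 (1 / k.factorial)) := by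
  have hne : ∀ᶠ m : ℕ in atTop, ((m : ℝ) ^ k / k.factorial) ≠ 0 := by
    filter_upwards [eventually_gt_atTop 0] with m hm
    positivity
  have h := ((Asymptotics.isEquivalent_iff_tendsto_one hne).mp
    (isEquivalent_choose k)).div_const (k.factorial : ℝ)
  refine h.congr fun m => ?_
  have : (k.factorial : ℝ) ≠ 0 := by positivity
  simp only [Pi.div_apply]
  field_simp

/-- The range of summation is independent of `m`, so limits can be taken termwise. -/
theorem eval_aeval_normalizedLaguerre {α : ℝ} (F : ℂ[X]) (κ z : ℂ) {m : ℕ} (hm : F.natDegree ≤ m) :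
    (aeval (κ • (derivative : Module.End ℂ ℂ[X]) ^ 2) (normalizedLaguerre m α) F).eval z =
      ∑ k ∈ Finset.range (F.natDegree + 1),
        (((-1) ^ k * m.choose k / shiftedPochhammer α k : ℝ) : ℂ) *
          (κ ^ k * (derivative^[2 * k] F).eval z) := by
  have h : (aeval (κ • (derivative : Module.End ℂ ℂ[X]) ^ 2) (normalizedLaguerre m α) F).eval z =
      ∑ k ∈ Finset.range (m + 1),
        (((-1) ^ k * m.choose k / shiftedPochhammer α k : ℝ) : ℂ) *
          (κ ^ k * (derivative^[2 * k] F).eval z) := by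
    rw [normalizedLaguerre, map_sum, LinearMap.sum_apply, eval_finsetSum]
    refine Finset.sum_congr rfl fun k _ => ?_
    rw [map_mul, map_pow, aeval_X, aeval_C, Module.End.mul_apply, Module.algebraMap_end_apply,
      _root_.smul_pow, LinearMap.smul_apply, ← pow_mul, Module.End.pow_apply, eval_smul, eval_smul,
      smul_eq_mul, smul_eq_mul]
  rw [h]
  refine (Finset.sum_subset (Finset.range_subset_range.mpr (by omega)) fun k _ hk => ?_).symm
  rw [iterate_derivative_eq_zero (by simp at hk; omega), eval_zero, mul_zero, mul_zero]

theorem aeval_ultrasphericalTransform_ne_zero {α : ℝ} (hα : -1 < α) {f : ℝ[X]}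
    (hf : AllZerosInUnitInterval f) (hf0 : f ≠ 0) {z : ℂ}
    (hz : ¬∃ x : ℝ, x ∈ Set.Ioo (-1 : ℝ) 1 ∧ z = x) (hz1 : 1 - z ^ 2 ≠ 0) :
    aeval z (ultrasphericalTransform α f) ≠ 0 := by
  intro hT
  obtain ⟨c, hc⟩ := IsAlgClosed.exists_pow_nat_eq (1 - z ^ 2) (n := 2) two_pos
  have hc0 : c ≠ 0 := by
    rintro rfl
    exact hz1 (by rw [← hc]; simp)
  obtain ⟨u, huc, huz⟩ := exists_abs_re_lt_re_mul hz hc hc0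
  have hu : u ≠ 0 := by
    rintro rfl
    simp at huz
  set F : ℂ[X] := f.map (algebraMap ℝ ℂ) with hF
  have hF0 : F ≠ 0 := (Polynomial.map_ne_zero_iff (algebraMap ℝ ℂ).injective).mpr hf0
  have hFz : ZerosInHalfPlane u |u.re| F := by
    intro w hw
    rw [hF, eval_map_algebraMap] at hw
    obtain ⟨x, hx, rfl⟩ := hf w hw
    rw [Complex.re_mul_ofReal]
    calc u.re * x ≤ |u.re * x| := le_abs_self _
      _ = |u.re| * |x| := abs_mul _ _
      _ ≤ |u.re| := mul_le_of_le_one_right (abs_nonneg _) (abs_le.mpr ⟨hx.1.le, hx.2.le⟩)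
  -- The scale `1/(4m)` turns `binom(m,k)` into `binom(m,k)/m^k → 1/k!` and supplies the `4^(-k)` of
  -- the series.
  set G : ℕ → ℂ[X] := fun m =>
    aeval ((c ^ 2 * ((1 / (4 * m) : ℝ) : ℂ)) • (derivative : Module.End ℂ ℂ[X]) ^ 2)
      (normalizedLaguerre m α) F with hG
  have hbound : ∀ m, ‖F.leadingCoeff‖ * (((u * z).re - |u.re|) / ‖u‖) ^ F.natDegree ≤
      ‖(G m).eval z‖ := by
    intro m
    obtain ⟨h1, h2, h3⟩ := hFz.aeval_derivative_sq huc (t := 1 / (4 * m)) (by positivity)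
      (hasPositiveZeros_normalizedLaguerre m hα)
    rw [eval_zero_normalizedLaguerre, one_mul] at h3
    rw [← h2, ← h3]
    refine h1.le_norm_eval ?_ huz
    rw [← leadingCoeff_ne_zero, h3, leadingCoeff_ne_zero]
    exact hF0
  have hlim : Tendsto (fun m => (G m).eval z) atTop (𝓝 0) := by
    have hexp := aeval_ultrasphericalTransform hα f z
    rw [hT, mul_zero] at hexp
    have hdeg : F.natDegree = f.natDegree := natDegree_map _
    rw [hexp, ← hdeg]
    refine Tendsto.congr' (f₁ := fun m : ℕ => ∑ k ∈ Finset.range (F.natDegree + 1),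
      (((m.choose k : ℝ) / (m : ℝ) ^ k : ℝ) : ℂ) * ((-(c ^ 2 / 4)) ^ k / shiftedPochhammer α k *
        (derivative^[2 * k] F).eval z)) ?_ ?_
    · filter_upwards [eventually_ge_atTop F.natDegree] with m hm
      rw [hG]
      simp only
      rw [eval_aeval_normalizedLaguerre F _ z hm]
      refine Finset.sum_congr rfl fun k _ => ?_
      have h4 : (c ^ 2 * ((1 / (4 * m) : ℝ) : ℂ)) = c ^ 2 / 4 * (m : ℂ)⁻¹ := by
        push_cast
        ring
      rw [h4, neg_pow, mul_pow]
      push_cast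
      ring
    · refine tendsto_finsetSum _ fun k _ => ?_
      have h5 := ((Complex.continuous_ofReal.tendsto _).comp (tendsto_choose_div_pow k)).mul_const
        ((-(c ^ 2 / 4)) ^ k / shiftedPochhammer α k * (derivative^[2 * k] F).eval z)
      convert h5 using 2
      · rfl
      rw [hF, iterate_derivative_map, eval_map_algebraMap, hc]
      push_cast
      ring
  have hpos : 0 < ‖F.leadingCoeff‖ * (((u * z).re - |u.re|) / ‖u‖) ^ F.natDegree :=
    mul_pos (norm_pos_iff.mpr (leadingCoeff_ne_zero.mpr hF0))
      (pow_pos (div_pos (sub_pos.mpr huz) (norm_pos_iff.mpr hu)) _)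
  have hle := ge_of_tendsto' hlim.norm hbound
  rw [norm_zero] at hle
  exact hpos.not_ge hle

theorem allZerosInUnitInterval_ultrasphericalTransform {α : ℝ} (hα : -1 < α) {f : ℝ[X]}
    (hf : AllZerosInUnitInterval f) : AllZerosInUnitInterval (ultrasphericalTransform α f) := by
  have hf0 : f ≠ 0 := by
    rintro rfl
    obtain ⟨x, hx, h⟩ := hf 2 (map_zero _)
    have : (2 : ℝ) = x := by exact_mod_cast h
    linarith [hx.2]
  intro z hz
  by_contra hzI
  by_cases hz1 : 1 - z ^ 2 = 0
  · have hexp := aeval_ultrasphericalTransform hα f z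
    rw [hz, mul_zero, hz1, Finset.sum_range_succ', Finset.sum_eq_zero] at hexp
    · refine hzI (hf z ?_)
      simpa [shiftedPochhammer_zero] using hexp.symm
    · intro j _
      simp
  · exact aeval_ultrasphericalTransform_ne_zero hα hf hf0 hzI hz1 hz

theorem legendreTransform_eq_ultrasphericalTransform (f : ℝ[X]) :
    legendreTransform f = ultrasphericalTransform 0 f := by
  refine Finset.sum_congr rfl fun k _ => ?_
  rw [add_zero, Real.Gamma_nat_eq_factorial, div_self (by positivity), mul_one]
  rfl

theorem theorem1 :
    (∀ (α : ℝ), -1 < α → ∀ f : Polynomial ℝ, AllZerosInUnitInterval f →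
      AllZerosInUnitInterval (ultrasphericalTransform α f)) ∧
    (∀ f : Polynomial ℝ, AllZerosInUnitInterval f →
      AllZerosInUnitInterval (legendreTransform f)) := by
  refine ⟨fun α hα f hf => allZerosInUnitInterval_ultrasphericalTransform hα hf, fun f hf => ?_⟩
  rw [legendreTransform_eq_ultrasphericalTransform]
  exact allZerosInUnitInterval_ultrasphericalTransform (by norm_num) hf
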